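/- Let $m\in\mathbb N$, let $A\in\mathbb R^{m\times m}$, and let $B=(B_t)_{t\ge 0}$ be a standard Brownian motion in $\mathbb R^m$ on a probability space $(\Omega,\mathcal A,\mathbb P)$. For $x\in\mathbb R^m$ let $(X_t(x))_{t\ge 0}$ be the solution of $$\mathrm dX_t(x)=-AX_t(x)\,\mathrm dt+\mathrm dB_t,\qquad X_0(x)=x,$$ and let $\mu$ be its stationary (invariant) probability distribution on $\mathbb R^m$. Let $\mathcal W_2$ be the Wasserstein distance of order $2$, $$\mathcal W_2(\mu_1,\mu_2)=\Big(\inf_{\mathcal T}\int_{\mathbb R^m\times\mathbb R^m}|u-v|^2\,\mathcal T(\mathrm du,\mathrm dv)\Big)^{1/2},$$ where the infimum is over all couplings $\mathcal T$ of $\mu_1$ and $\mu_2$, and write $\mathcal W_2(X_t(x),\mu)$ for the distance between the law of $X_t(x)$ and $\mu$. (1) Assume that $A$ is symmetric positive definite with eigenvalues $\lambda_1,\dots,\lambda_m>0$ and corresponding orthonormal eigenvectors $v_1,\dots,v_m\in\mathbb R^m$. Then for all $x\in\mathbb R^m$ and $t\ge 0$ $$\mathcal W_2(X_t(x),\mu)=\left(\sum_{j=1}^m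 e^{-2\lambda_jt}\langle x,v_j\rangle^2+\frac12\sum_{j=1}^m\frac1{\lambda_j}\,\frac{e^{-4\lambda_jt}}{\big(\sqrt{1-e^{-2\lambda_jt}}+1\big)^2}\right)^{1/2}.$$ (2) Assume that $A$ is normal, that is, $AA^*=A^*A$, with eigenvalues $\lambda_1,\dots,\lambda_m\in\mathbb C$ such that $\mathrm{Re}(\lambda_j)>0$ for all $j$, and corresponding orthonormal eigenvectors $v_1,\dots,v_m\in\mathbb C^m$. Then for all $x\in\mathbb R^m$ and $t\ge 0$ $$\mathcal W_2(X_t(x),\mu)=\left(\sum_{j=1}^m e^{-2\mathrm{Re}(\lambda_j)t}\Big(\langle x,\mathrm{Re}(v_j)\rangle^2+\langle x,\mathrm{Im}(v_j)\rangle^2\Big)+\sum_{j=1}^m\frac1{2\mathrm{Re}(\lambda_j)}\,\frac{e^{-4\mathrm{Re}(\lambda_j)t}}{\big(\sqrt{1-e^{-2\mathrm{Re}(\lambda_j)t}}+1\big)^2}\right)^{1/2}.$$ -/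

import Mathlib

open MeasureTheory ProbabilityTheory
open scoped NNReal ENNReal

noncomputable section

/-- The couplings (joint distributions) of two measures `μ` and `ν`. -/
def couplings {E : Type*} [MeasurableSpace E] (μ ν : Measure E) : Set (Measure (E × E)) :=
  {π | π.map Prod.fst = μ ∧ π.map Prod.snd = ν}

/-- The Wasserstein-Kantorovich-Rubinstein distance of order `p > 0`, with values in `[0, ∞]`
(so that no integrability convention is involved). -/
def wassersteinDist {E : Type*} [MeasurableSpace E] [EDist E] (p : ℝ) (μ ν : Measure E) : ℝ≥0∞ :=
  (⨅ π ∈ couplings μ ν, ∫⁻ z, edist z.1 z.2 ^ p ∂π) ^ min 1 (1 / p)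

/-- `B` is a standard Brownian motion in `ℝⁿ`: its components are independent standard
one-dimensional Brownian motions (started in `0`, with almost surely continuous paths). -/
structure IsStandardBrownianMotion {n : ℕ} {Ω : Type*} [MeasurableSpace Ω]
    (B : ℝ≥0 → Ω → EuclideanSpace ℝ (Fin n)) (P : Measure Ω) : Prop where
  isBrownianReal : ∀ i : Fin n, IsBrownianReal (fun t ω => B t ω i) P
  indep : iIndepFun (fun (i : Fin n) (ω : Ω) (t : ℝ≥0) => B t ω i) P

/-- `X` solves the linear stochastic differential equation with additive noise
`dX_t = -A X_t dt + σ dB_t`, `X_0 = x`, for a driving process `B` with continuous paths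
and `B_0 = 0`: almost surely, `X` has continuous paths and
`X_t = x - ∫₀ᵗ A X_s ds + σ B_t` for all `t ≥ 0`.
As the noise is additive with constant coefficient, no stochastic integral is needed. -/
def IsOrnsteinUhlenbeck {m n : ℕ} {Ω : Type*} [MeasurableSpace Ω]
    (A : Matrix (Fin m) (Fin m) ℝ) (σ : Matrix (Fin m) (Fin n) ℝ)
    (B : ℝ≥0 → Ω → EuclideanSpace ℝ (Fin n)) (P : Measure Ω)
    (x : EuclideanSpace ℝ (Fin m)) (X : ℝ≥0 → Ω → EuclideanSpace ℝ (Fin m)) : Prop :=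
  ∀ᵐ ω ∂P, Continuous (fun t => X t ω) ∧
    ∀ t : ℝ≥0, X t ω = x - (∫ s in (0 : ℝ)..(t : ℝ), Matrix.toEuclideanLin A (X s.toNNReal ω))
      + Matrix.toEuclideanLin σ (B t ω)

/-- `μ` is an invariant (stationary) probability distribution of the random dynamics
`x ↦ (X_t(x))_{t ≥ 0}`: if the initial value is distributed according to `μ`, independently of the
noise, then so is the value at each time `t`, that is, `∫ ℙ(X_t(x) ∈ S) μ(dx) = μ(S)`. -/
structure IsInvariantDistribution {E Ω : Type*} [MeasurableSpace E] [MeasurableSpace Ω]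
    (X : E → ℝ≥0 → Ω → E) (P : Measure Ω) (μ : Measure E) : Prop where
  isProbabilityMeasure : IsProbabilityMeasure μ
  invariant : ∀ (t : ℝ≥0) (S : Set E), MeasurableSet S → ∫⁻ x, P.map (X x t) S ∂μ = μ S

end

/-! Let `S = (A + Aᵀ)/2`, with real orthonormal eigenbasis `u` and eigenvalues `s k > 0`. Normality
gives `e^{-rA} e^{-rAᵀ} = e^{-2rS}`, so the covariance `∫₀ᵀ e^{-rA} e^{-rAᵀ} dr` of the process at
time `T` is diagonal in `u`, with entries `(1 - e^{-2 s k T}) / (2 s k)`. The law at time `T` is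
thus Gaussian with mean `e^{-TA} x` and this covariance (`map_ornsteinUhlenbeck_eq_diagGaussian`),
and the invariant law is the centered Gaussian with entries `1 / (2 s k)` in the same basis
(`invariant_eq_diagGaussian`).

For Gaussians diagonal in a common basis, the squared distance is the squared distance of the means
plus `∑ (σ k - τ k)²` (`wassersteinDist_diagGaussian`): Cauchy-Schwarz in each coordinate gives the
lower bound, and driving both laws by one standard Gaussian attains it.

No stochastic integration is needed: variation of constants holds path by path after partial
integration, and the resulting Wiener integral is a limit of Riemann sums whose characteristic
functions are explicit.

Finally the sums over `u` are rewritten through the complex eigenvectors of `A`, since `f(S)` acts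
on them by `f (Re λ)` (`sum_eigenvalues_mul_norm_inner_sq`, `sum_eigenvalues_eq`). The positive
definite case is the normal case with real eigenvectors. -/

/-! ### Wasserstein distance of Gaussians with a common eigenbasis. -/

section GaussianWasserstein

variable {E ι : Type*} [NormedAddCommGroup E] [InnerProductSpace ℝ E] [Fintype ι]

/-- The affine map `z ↦ a + ∑ k, σ k ⟨u k, z⟩ u k`, diagonal in the orthonormal basis `u`. -/
noncomputable def diagAffine (u : OrthonormalBasis ι ℝ E) (a : E) (σ : ι → ℝ) (z : E) : E :=
  a + ∑ k, (σ k * inner ℝ (u k) z) • u k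

lemma continuous_diagAffine (u : OrthonormalBasis ι ℝ E) (a : E) (σ : ι → ℝ) :
    Continuous (diagAffine u a σ) := by
  unfold diagAffine; fun_prop

lemma inner_diagAffine (u : OrthonormalBasis ι ℝ E) (a : E) (σ : ι → ℝ) (k : ι) (z : E) :
    inner ℝ (u k) (diagAffine u a σ z) = inner ℝ (u k) a + σ k * inner ℝ (u k) z := by
  classical
  simp [diagAffine, inner_add_right, inner_sum, inner_smul_right,
    OrthonormalBasis.inner_eq_ite]

/-- Parseval in the basis `u` splits the transport cost into one-dimensional costs; square
integrability turns the extended integral into real ones. -/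
lemma lintegral_edist_sq_eq [MeasurableSpace E] {π : Measure (E × E)} (u : OrthonormalBasis ι ℝ E)
    (h : ∀ k, MemLp (fun z : E × E => inner ℝ (u k) z.1 - inner ℝ (u k) z.2) 2 π) :
    ∫⁻ z, edist z.1 z.2 ^ (2 : ℝ) ∂π
      = ENNReal.ofReal (∑ k, ∫ z, (inner ℝ (u k) z.1 - inner ℝ (u k) z.2) ^ 2 ∂π) := by
  rw [← integral_finsetSum _ (fun k _ => (h k).integrable_sq),
    ofReal_integral_eq_lintegral_ofReal (integrable_finsetSum _ fun k _ => (h k).integrable_sq)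
      (Filter.Eventually.of_forall fun z => Finset.sum_nonneg fun k _ => sq_nonneg _)]
  refine lintegral_congr fun z => ?_
  rw [edist_dist, ENNReal.ofReal_rpow_of_nonneg dist_nonneg (by norm_num), dist_eq_norm,
    Real.rpow_two, ← u.sum_sq_inner_right]
  simp_rw [inner_sub_right]

variable [FiniteDimensional ℝ E] [MeasurableSpace E] [BorelSpace E]

/-- The Gaussian measure with mean `a` whose covariance is diagonal in the orthonormal basis `u`,
with standard deviation `σ k` along `u k`. -/
noncomputable def diagGaussian (u : OrthonormalBasis ι ℝ E) (a : E) (σ : ι → ℝ) : Measure E :=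
  (stdGaussian E).map (diagAffine u a σ)

instance (u : OrthonormalBasis ι ℝ E) (a : E) (σ : ι → ℝ) :
    IsProbabilityMeasure (diagGaussian u a σ) :=
  Measure.isProbabilityMeasure_map (continuous_diagAffine u a σ).aemeasurable

lemma charFun_diagGaussian (u : OrthonormalBasis ι ℝ E) (a : E) (σ : ι → ℝ) (ξ : E) :
    charFun (diagGaussian u a σ) ξ =
      Complex.exp ((inner ℝ a ξ : ℝ) * Complex.I)
        * Complex.exp (-((∑ k, σ k ^ 2 * inner ℝ (u k) ξ ^ 2 : ℝ) : ℂ) / 2) := by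
  classical
  -- The linear part of `diagAffine` is self-adjoint, so it moves onto `ξ`; `η` is its image.
  set η : E := ∑ k, (σ k * inner ℝ (u k) ξ) • u k with hη
  have hn : ‖η‖ ^ 2 = ∑ k, σ k ^ 2 * inner ℝ (u k) ξ ^ 2 := by
    rw [← u.sum_sq_inner_right η]
    refine Finset.sum_congr rfl fun k _ => ?_
    simp [hη, inner_sum, inner_smul_right, OrthonormalBasis.inner_eq_ite, mul_pow]
  have hz : ∀ z, inner ℝ (diagAffine u a σ z) ξ = inner ℝ a ξ + inner ℝ z η := by
    intro z
    simp only [diagAffine, inner_add_left, sum_inner, inner_smul_left, hη, inner_sum,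
      inner_smul_right]
    congr 1
    refine Finset.sum_congr rfl fun k _ => ?_
    rw [real_inner_comm z (u k)]
    simp; ring
  have h := charFun_stdGaussian η
  rw [charFun_apply] at h
  rw [charFun_apply, diagGaussian, integral_map (continuous_diagAffine u a σ).aemeasurable
    (by fun_prop)]
  simp_rw [hz, Complex.ofReal_add, add_mul, Complex.exp_add]
  rw [integral_const_mul, h, ← hn]
  push_cast
  rfl

lemma memLp_inner_stdGaussian (v : E) :
    MemLp (fun z => inner ℝ v z) 2 (stdGaussian E) := by
  have h : (fun z => inner ℝ v z) = innerSL ℝ v := funext fun z => (innerSL_apply_apply ℝ v z).symm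
  rw [h]
  exact IsGaussian.memLp_dual (stdGaussian E) (innerSL ℝ v) 2 (by simp)

lemma memLp_inner_diagGaussian (u : OrthonormalBasis ι ℝ E) (a : E) (σ : ι → ℝ) (k : ι) :
    MemLp (fun z => inner ℝ (u k) z) 2 (diagGaussian u a σ) := by
  rw [diagGaussian, memLp_map_measure_iff (by fun_prop)
    (continuous_diagAffine u a σ).aemeasurable]
  have : (fun z => inner ℝ (u k) z) ∘ diagAffine u a σ
      = fun z => inner ℝ (u k) a + σ k * inner ℝ (u k) z := by
    funext z; exact inner_diagAffine u a σ k z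
  rw [this]
  have h1 : MemLp (fun _ : E => inner ℝ (u k) a) 2 (stdGaussian E) := memLp_const _
  have h2 : MemLp (fun z => σ k * inner ℝ (u k) z) 2 (stdGaussian E) :=
    (memLp_inner_stdGaussian (u k)).const_mul (σ k)
  exact h1.add h2

lemma integral_inner_diagGaussian (u : OrthonormalBasis ι ℝ E) (a : E) (σ : ι → ℝ) (k : ι) :
    ∫ z, inner ℝ (u k) z ∂(diagGaussian u a σ) = inner ℝ (u k) a := by
  rw [diagGaussian, integral_map (continuous_diagAffine u a σ).aemeasurable (by fun_prop)]
  simp_rw [inner_diagAffine]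
  have h1 := memLp_inner_stdGaussian (u k)
  have h2 : ∫ z, inner ℝ (u k) z ∂(stdGaussian E) = 0 :=
    integral_strongDual_stdGaussian (innerSL ℝ (u k))
  rw [integral_add (integrable_const _) ((h1.integrable (by norm_num)).const_mul _),
    integral_const_mul, h2]
  simp

lemma variance_inner_stdGaussian (u : OrthonormalBasis ι ℝ E) (k : ι) :
    Var[fun z => inner ℝ (u k) z; stdGaussian E] = 1 := by
  have := variance_dual_stdGaussian (innerSL ℝ (u k))
  simpa using this

lemma variance_inner_diagGaussian (u : OrthonormalBasis ι ℝ E) (a : E) (σ : ι → ℝ) (k : ι) :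
    Var[fun z => inner ℝ (u k) z; diagGaussian u a σ] = σ k ^ 2 := by
  rw [diagGaussian, variance_map (by fun_prop) (continuous_diagAffine u a σ).aemeasurable]
  have : (fun z => inner ℝ (u k) z) ∘ diagAffine u a σ
      = fun z => inner ℝ (u k) a + σ k * inner ℝ (u k) z := by
    funext z; exact inner_diagAffine u a σ k z
  rw [this, variance_const_add (by fun_prop), variance_const_mul, variance_inner_stdGaussian,
    mul_one]

/-- Cauchy-Schwarz: the variance of `c U - V` is a nonnegative quadratic in `c`, so its discriminant
is at most zero. -/
lemma covariance_sq_le {Ω : Type*} [MeasurableSpace Ω] {P : Measure Ω} [IsProbabilityMeasure P]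
    {U V : Ω → ℝ} (hU : MemLp U 2 P) (hV : MemLp V 2 P) :
    cov[U, V; P] ^ 2 ≤ Var[U; P] * Var[V; P] := by
  have h : ∀ c : ℝ, 0 ≤ Var[U; P] * (c * c) + (-2 * cov[U, V; P]) * c + Var[V; P] := by
    intro c
    have h1 := variance_nonneg (c • U - V) P
    rw [variance_sub (hU.const_smul c) hV, variance_smul, covariance_smul_left] at h1
    linarith
  have := discrim_le_zero h
  rw [discrim] at this
  nlinarith

/-- The covariance is at most `σ τ` by Cauchy-Schwarz. This is the lower bound on the cost of any
coupling, one coordinate at a time. -/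
lemma sq_sub_le_variance_sub {Ω : Type*} [MeasurableSpace Ω] {P : Measure Ω}
    [IsProbabilityMeasure P] {U V : Ω → ℝ} (hU : MemLp U 2 P) (hV : MemLp V 2 P) {σ τ : ℝ}
    (hσ : 0 ≤ σ) (hτ : 0 ≤ τ) (hUσ : Var[U; P] = σ ^ 2) (hVτ : Var[V; P] = τ ^ 2) :
    (σ - τ) ^ 2 ≤ Var[U - V; P] := by
  have h := covariance_sq_le hU hV
  rw [hUσ, hVτ, ← mul_pow] at h
  have h2 := abs_le_of_sq_le_sq' h (by positivity)
  rw [variance_sub hU hV, hUσ, hVτ]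
  nlinarith [h2.2]

lemma integral_sq_eq_sq_add_variance {Ω : Type*} [MeasurableSpace Ω] {P : Measure Ω}
    [IsProbabilityMeasure P] {U : Ω → ℝ} (hU : MemLp U 2 P) :
    ∫ ω, U ω ^ 2 ∂P = (∫ ω, U ω ∂P) ^ 2 + Var[U; P] := by
  rw [variance_eq_sub hU]
  simp

/-- The squared Wasserstein distance of two Gaussian measures whose covariances are
simultaneously diagonalizable. -/
theorem wassersteinDist_diagGaussian (u : OrthonormalBasis ι ℝ E) (a b : E) (σ τ : ι → ℝ)
    (hσ : ∀ k, 0 ≤ σ k) (hτ : ∀ k, 0 ≤ τ k) :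
    wassersteinDist 2 (diagGaussian u a σ) (diagGaussian u b τ)
      = ENNReal.ofReal (Real.sqrt (‖a - b‖ ^ 2 + ∑ k, (σ k - τ k) ^ 2)) := by
  have key : (⨅ π ∈ couplings (diagGaussian u a σ) (diagGaussian u b τ),
      ∫⁻ z, edist z.1 z.2 ^ (2 : ℝ) ∂π)
      = ENNReal.ofReal (‖a - b‖ ^ 2 + ∑ k, (σ k - τ k) ^ 2) := by
    have hsum : ‖a - b‖ ^ 2 + ∑ k, (σ k - τ k) ^ 2
        = ∑ k, ((inner ℝ (u k) a - inner ℝ (u k) b) ^ 2 + (σ k - τ k) ^ 2) := by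
      rw [← u.sum_sq_inner_right, Finset.sum_add_distrib]
      simp_rw [inner_sub_right]
    have hdata : ∀ π ∈ couplings (diagGaussian u a σ) (diagGaussian u b τ),
        IsProbabilityMeasure π ∧ ∀ k,
          MemLp (fun z : E × E => inner ℝ (u k) z.1) 2 π ∧
          MemLp (fun z : E × E => inner ℝ (u k) z.2) 2 π ∧
          ∫ z, inner ℝ (u k) z.1 ∂π = inner ℝ (u k) a ∧
          ∫ z, inner ℝ (u k) z.2 ∂π = inner ℝ (u k) b ∧
          Var[fun z : E × E => inner ℝ (u k) z.1; π] = σ k ^ 2 ∧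
          Var[fun z : E × E => inner ℝ (u k) z.2; π] = τ k ^ 2 := by
      rintro π ⟨h1, h2⟩
      refine ⟨⟨?_⟩, fun k => ⟨?_, ?_, ?_, ?_, ?_, ?_⟩⟩
      · have := measure_univ (μ := diagGaussian u a σ)
        rwa [← h1, Measure.map_apply measurable_fst .univ, Set.preimage_univ] at this
      · have := memLp_inner_diagGaussian u a σ k
        rw [← h1, memLp_map_measure_iff (by fun_prop) (by fun_prop)] at this
        exact this
      · have := memLp_inner_diagGaussian u b τ k
        rw [← h2, memLp_map_measure_iff (by fun_prop) (by fun_prop)] at this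
        exact this
      · have := integral_inner_diagGaussian u a σ k
        rw [← h1, integral_map (by fun_prop) (by fun_prop)] at this
        exact this
      · have := integral_inner_diagGaussian u b τ k
        rw [← h2, integral_map (by fun_prop) (by fun_prop)] at this
        exact this
      · have := variance_inner_diagGaussian u a σ k
        rw [← h1, variance_map (by fun_prop) (by fun_prop)] at this
        exact this
      · have := variance_inner_diagGaussian u b τ k
        rw [← h2, variance_map (by fun_prop) (by fun_prop)] at this
        exact this
    -- The marginals fix the means, so only the variance of the coordinate differences depends on
    -- the coupling.
    have hcost : ∀ π ∈ couplings (diagGaussian u a σ) (diagGaussian u b τ),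
        ∫⁻ z, edist z.1 z.2 ^ (2 : ℝ) ∂π = ENNReal.ofReal
          (∑ k, ((inner ℝ (u k) a - inner ℝ (u k) b) ^ 2 + Var[(fun z : E × E => inner ℝ (u k) z.1)
            - (fun z : E × E => inner ℝ (u k) z.2); π])) := by
      intro π hπ
      obtain ⟨hp, h⟩ := hdata π hπ
      rw [lintegral_edist_sq_eq u fun k => (h k).1.sub (h k).2.1]
      congr 1
      refine Finset.sum_congr rfl fun k _ => ?_
      obtain ⟨m1, m2, i1, i2, -, -⟩ := h k
      have h3 := integral_sq_eq_sq_add_variance (m1.sub m2)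
      simp only [Pi.sub_apply] at h3
      rw [h3, integral_sub (m1.integrable (by norm_num)) (m2.integrable (by norm_num)), i1, i2]
    rw [hsum]
    refine le_antisymm ?_ (le_iInf₂ fun π hπ => ?_)
    -- The optimal coupling: one standard Gaussian sample is sent through both affine maps, so each
    -- coordinate difference has standard deviation `|σ k - τ k|`.
    · have hm : Measurable fun z => (diagAffine u a σ z, diagAffine u b τ z) :=
        (continuous_diagAffine u a σ).measurable.prodMk (continuous_diagAffine u b τ).measurable
      have hmem : (stdGaussian E).map (fun z => (diagAffine u a σ z, diagAffine u b τ z)) ∈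
          couplings (diagGaussian u a σ) (diagGaussian u b τ) := by
        constructor
        · rw [Measure.map_map measurable_fst hm]; rfl
        · rw [Measure.map_map measurable_snd hm]; rfl
      refine (iInf₂_le _ hmem).trans ?_
      rw [hcost _ hmem]
      refine le_of_eq (congrArg _ (Finset.sum_congr rfl fun k _ => ?_))
      congr 1
      rw [variance_map (by fun_prop) hm.aemeasurable]
      have : ((fun z : E × E => inner ℝ (u k) z.1) - (fun z : E × E => inner ℝ (u k) z.2))
          ∘ (fun z => (diagAffine u a σ z, diagAffine u b τ z))
          = fun z => (inner ℝ (u k) a - inner ℝ (u k) b) + (σ k - τ k) * inner ℝ (u k) z := by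
        funext z
        simp only [Function.comp_apply, Pi.sub_apply, inner_diagAffine]
        ring
      rw [this, variance_const_add (by fun_prop), variance_const_mul, variance_inner_stdGaussian,
        mul_one]
    · obtain ⟨hp, h⟩ := hdata π hπ
      rw [hcost π hπ]
      refine ENNReal.ofReal_le_ofReal (Finset.sum_le_sum fun k _ => ?_)
      obtain ⟨m1, m2, -, -, v1, v2⟩ := h k
      gcongr
      exact sq_sub_le_variance_sub m1 m2 (hσ k) (hτ k) v1 v2
  have hmin : min 1 (1 / (2 : ℝ)) = 1 / 2 := by norm_num
  rw [wassersteinDist, key, hmin, ENNReal.ofReal_rpow_of_nonneg (by positivity) (by norm_num),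
    Real.sqrt_eq_rpow]

end GaussianWasserstein

/-! ### Wiener integrals of deterministic differentiable integrands. -/

section WienerIntegral

open Filter Topology

section Paths

variable {E : Type*} [NormedAddCommGroup E] [InnerProductSpace ℝ E]

/-- The `k`-th point of the partition of `[0, T]` into `n + 1` intervals of equal length. -/
noncomputable def uniformPartition (T : ℝ) (n k : ℕ) : ℝ := T * k / (n + 1)

lemma uniformPartition_zero (T : ℝ) (n : ℕ) : uniformPartition T n 0 = 0 := by
  simp [uniformPartition]

lemma uniformPartition_last (T : ℝ) (n : ℕ) : uniformPartition T n (n + 1) = T := by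
  have : (n : ℝ) + 1 ≠ 0 := by positivity
  simp [uniformPartition, this]

lemma uniformPartition_succ_sub (T : ℝ) (n k : ℕ) :
    uniformPartition T n (k + 1) - uniformPartition T n k = T / (n + 1) := by
  simp only [uniformPartition]; push_cast; ring

lemma uniformPartition_mono {T : ℝ} (hT : 0 ≤ T) (n : ℕ) : Monotone (uniformPartition T n) := by
  intro i j hij
  unfold uniformPartition
  gcongr

lemma uniformPartition_nonneg {T : ℝ} (hT : 0 ≤ T) (n k : ℕ) : 0 ≤ uniformPartition T n k := by
  unfold uniformPartition; positivity

/-- Uniform continuity of `b` on `[0, T]` against the bound on `φ`. The tags are arbitrary points of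
the closed cells, since both left and right endpoints are needed later. -/
lemma tendsto_sum_integral_inner_tagged {φ b : ℝ → E} (hφ : Continuous φ) (hb : Continuous b)
    {T : ℝ} (hT : 0 ≤ T) {c : ℕ → ℕ → ℝ}
    (hc : ∀ n k, c n k ∈ Set.Icc (uniformPartition T n k) (uniformPartition T n (k + 1))) :
    Tendsto (fun n => ∑ k ∈ Finset.range (n + 1),
        ∫ s in (uniformPartition T n k)..(uniformPartition T n (k + 1)),
          (inner ℝ (φ s) (b (c n k)) : ℝ))
      atTop (𝓝 (∫ s in (0 : ℝ)..T, (inner ℝ (φ s) (b s) : ℝ))) := by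
  obtain ⟨C, hC⟩ := (isCompact_Icc (a := (0 : ℝ)) (b := T)).exists_bound_of_continuousOn
    hφ.continuousOn
  have hC0 : 0 ≤ C := (norm_nonneg _).trans (hC 0 ⟨le_rfl, hT⟩)
  have huc := (isCompact_Icc (a := (0 : ℝ)) (b := T)).uniformContinuousOn_of_continuous
    hb.continuousOn
  rw [Metric.tendsto_atTop]
  intro ε hε
  -- The `+ 1` covers `C * T = 0` and makes the final estimate strict.
  have hpos : 0 < C * T + 1 := by positivity
  obtain ⟨δ, hδ, huc⟩ := Metric.uniformContinuousOn_iff.1 huc (ε / (C * T + 1)) (by positivity)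
  obtain ⟨N, hN⟩ := exists_nat_gt (T / δ)
  refine ⟨N, fun n hn => ?_⟩
  have hmesh : T / (n + 1) < δ := by
    have : (N : ℝ) ≤ n := by exact_mod_cast hn
    rw [div_lt_iff₀ (by positivity)]
    rw [div_lt_iff₀ hδ] at hN
    nlinarith
  have hcont : Continuous fun s => (inner ℝ (φ s) (b s) : ℝ) := hφ.inner hb
  have hsplit := intervalIntegral.sum_integral_adjacent_intervals (μ := volume)
    (a := uniformPartition T n) (n := n + 1) (f := fun s => (inner ℝ (φ s) (b s) : ℝ))
    (fun k _ => hcont.intervalIntegrable _ _)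
  rw [uniformPartition_zero, uniformPartition_last] at hsplit
  rw [← hsplit, dist_eq_norm, ← Finset.sum_sub_distrib]
  have hterm : ∀ k ∈ Finset.range (n + 1),
      ‖(∫ s in (uniformPartition T n k)..(uniformPartition T n (k + 1)),
          (inner ℝ (φ s) (b (c n k)) : ℝ))
        - ∫ s in (uniformPartition T n k)..(uniformPartition T n (k + 1)),
          (inner ℝ (φ s) (b s) : ℝ)‖ ≤ C * (ε / (C * T + 1)) * (T / (n + 1)) := by
    intro k hk
    have hle : uniformPartition T n k ≤ uniformPartition T n (k + 1) :=
      uniformPartition_mono hT n (Nat.le_succ k)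
    have hk1 : uniformPartition T n (k + 1) ≤ T := by
      conv_rhs => rw [← uniformPartition_last T n]
      exact uniformPartition_mono hT n (Finset.mem_range.1 hk)
    have hk0 := uniformPartition_nonneg hT n k
    rw [← intervalIntegral.integral_sub ((hφ.inner continuous_const).intervalIntegrable _ _)
      (hcont.intervalIntegrable _ _)]
    have hstep := uniformPartition_succ_sub T n k
    refine (intervalIntegral.norm_integral_le_of_norm_le_const
      (C := C * (ε / (C * T + 1))) fun s hs => ?_).trans ?_
    · rw [Set.uIoc_of_le hle] at hs
      have hck := hc n k
      rw [← inner_sub_right]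
      refine (norm_inner_le_norm _ _).trans ?_
      have hs' : s ∈ Set.Icc 0 T := ⟨hk0.trans hs.1.le, hs.2.trans hk1⟩
      refine mul_le_mul (hC s hs') ?_ (norm_nonneg _) hC0
      rw [← dist_eq_norm]
      refine (huc _ ⟨hk0.trans hck.1, hck.2.trans hk1⟩ _ hs' ?_).le
      rw [Real.dist_eq, abs_lt]
      constructor <;> linarith [hs.1, hs.2, hck.1, hck.2]
    · rw [hstep, abs_of_nonneg (by positivity)]
  refine (norm_sum_le_of_le _ hterm).trans_lt ?_
  rw [Finset.sum_const, Finset.card_range, nsmul_eq_mul]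
  have : ((n + 1 : ℕ) : ℝ) * (C * (ε / (C * T + 1)) * (T / (n + 1)))
      = ε * (C * T / (C * T + 1)) := by
    push_cast; field_simp
  rw [this]
  have : C * T / (C * T + 1) < 1 := by rw [div_lt_one hpos]; linarith
  nlinarith

lemma tendsto_sum_left_endpoints {f : ℝ → ℝ} (hf : Continuous f) {T : ℝ} (hT : 0 ≤ T) :
    Tendsto (fun n => ∑ k ∈ Finset.range (n + 1), f (uniformPartition T n k) *
        (uniformPartition T n (k + 1) - uniformPartition T n k))
      atTop (𝓝 (∫ s in (0 : ℝ)..T, f s)) := by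
  have := tendsto_sum_integral_inner_tagged (φ := fun _ => (1 : ℝ)) continuous_const hf hT
    (c := fun n k => uniformPartition T n k)
    fun n k => ⟨le_rfl, uniformPartition_mono hT n (Nat.le_succ k)⟩
  simpa [mul_comm] using this

/-- Riemann sums for the integral of a continuously differentiable function against a continuous
path converge, by summation by parts. -/
lemma tendsto_sum_inner_increments {g g' b : ℝ → E} (hg : ∀ s, HasDerivAt g (g' s) s)
    (hg' : Continuous g') (hb : Continuous b) (hb0 : b 0 = 0) {T : ℝ} (hT : 0 ≤ T) :
    Tendsto (fun n => ∑ k ∈ Finset.range (n + 1), (inner ℝ (g (uniformPartition T n k))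
        (b (uniformPartition T n (k + 1)) - b (uniformPartition T n k)) : ℝ))
      atTop (𝓝 (inner ℝ (g T) (b T) - ∫ s in (0 : ℝ)..T, (inner ℝ (g' s) (b s) : ℝ))) := by
  -- Right endpoints, because `⟨g_k, b_{k+1} - b_k⟩ = (⟨g_{k+1}, b_{k+1}⟩ - ⟨g_k, b_k⟩) - ⟨g_{k+1} -
  -- g_k, b_{k+1}⟩`; the first part telescopes and the second is an integral of `g'` over the cell.
  have h1 := tendsto_sum_integral_inner_tagged hg' hb hT
    (c := fun n k => uniformPartition T n (k + 1))
    fun n k => ⟨uniformPartition_mono hT n (Nat.le_succ k), le_rfl⟩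
  refine (h1.const_sub (inner ℝ (g T) (b T) : ℝ)).congr fun n => ?_
  have h2 := Finset.sum_range_sub (fun k => (inner ℝ (g (uniformPartition T n k))
    (b (uniformPartition T n k)) : ℝ)) (n + 1)
  simp only [uniformPartition_last, uniformPartition_zero, hb0, inner_zero_right, sub_zero] at h2
  rw [← h2, ← Finset.sum_sub_distrib]
  refine Finset.sum_congr rfl fun k _ => ?_
  have hd : ∀ s, HasDerivAt (fun s => (inner ℝ (g s) (b (uniformPartition T n (k + 1))) : ℝ))
      (inner ℝ (g' s) (b (uniformPartition T n (k + 1)))) s := by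
    intro s
    simpa using (hg s).inner ℝ (hasDerivAt_const s (b (uniformPartition T n (k + 1))))
  rw [intervalIntegral.integral_eq_sub_of_hasDerivAt (fun s _ => hd s)
    ((hg'.inner continuous_const).intervalIntegrable _ _), inner_sub_right]
  ring

end Paths

variable {Ω : Type*} [MeasurableSpace Ω] {P : Measure Ω}

/-- Independent centered Gaussian increments: the characteristic functions multiply and the
variances add. -/
lemma charFun_sum_mul_increments [IsProbabilityMeasure P] {β : ℝ≥0 → Ω → ℝ}
    (hβ : IsPreBrownianReal β P) (h : ℕ → ℝ)
    {t : ℕ → ℝ≥0} (ht : Monotone t) (n : ℕ) (ξ : ℝ) :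
    charFun (P.map fun ω => ∑ k ∈ Finset.range n, h k * (β (t (k + 1)) ω - β (t k) ω)) ξ
      = Complex.exp (-((∑ k ∈ Finset.range n,
          h k ^ 2 * ((t (k + 1) : ℝ) - t k) : ℝ) : ℂ) * ξ ^ 2 / 2) := by
  have hind : iIndepFun (fun k ω => h k * (β (t (k + 1)) ω - β (t k) ω)) P :=
    (hβ.hasIndepIncrements.nat ht).comp (fun k x => h k * x) fun k => by fun_prop
  have hm : ∀ k, AEMeasurable (fun ω => β (t (k + 1)) ω - β (t k) ω) P := fun k =>
    (hβ.aemeasurable _).sub (hβ.aemeasurable _)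
  rw [iIndepFun.charFun_map_fun_finsetSum_eq_prod (s := Finset.range n)
    (fun k _ => (hm k).const_mul (h k)) (hind.restrict _), Finset.prod_apply]
  have hk : ∀ k, charFun (P.map fun ω => h k * (β (t (k + 1)) ω - β (t k) ω)) ξ
      = Complex.exp (-((h k ^ 2 * ((t (k + 1) : ℝ) - t k) : ℝ) : ℂ) * ξ ^ 2 / 2) := by
    intro k
    rw [charFun_map_mul_comp (hm k)]
    have hlaw := (hβ.hasLaw_sub (t (k + 1)) (t k)).map_eq
    have hlaw' : P.map (fun ω => β (t (k + 1)) ω - β (t k) ω)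
        = gaussianReal 0 (nndist (t (k + 1)).1 (t k).1) := hlaw
    have hle : ((t k : ℝ≥0) : ℝ) ≤ t (k + 1) := by exact_mod_cast ht (Nat.le_succ k)
    have hd : ((nndist (t (k + 1)).1 (t k).1 : ℝ≥0) : ℝ) = (t (k + 1) : ℝ) - t k := by
      rw [coe_nndist, Real.dist_eq]
      exact abs_of_nonneg (sub_nonneg.2 hle)
    have hd' : ((nndist (t (k + 1)).1 (t k).1 : ℝ≥0) : ℂ) = ((t (k + 1) : ℝ) - t k : ℝ) := by
      rw [← hd]
    rw [hlaw', charFun_gaussianReal, hd']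
    congr 1
    push_cast
    ring
  simp_rw [hk, ← Complex.exp_sum]
  congr 1
  push_cast
  rw [← Finset.sum_div, ← Finset.sum_mul, Finset.sum_neg_distrib]

variable {m : ℕ} {B : ℝ≥0 → Ω → EuclideanSpace ℝ (Fin m)}

lemma IsStandardBrownianMotion.aemeasurable (hB : IsStandardBrownianMotion B P) (t : ℝ≥0) :
    AEMeasurable (B t) P := by
  have h : AEMeasurable (fun ω i => B t ω i) P :=
    aemeasurable_pi_lambda _ fun i => (hB.isBrownianReal i).aemeasurable t
  exact (WithLp.measurable_toLp 2 _).comp_aemeasurable h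

lemma IsStandardBrownianMotion.ae_continuous (hB : IsStandardBrownianMotion B P) :
    ∀ᵐ ω ∂P, Continuous fun t => B t ω := by
  filter_upwards [ae_all_iff.2 fun i => (hB.isBrownianReal i).cont] with ω h
  exact (PiLp.continuous_toLp 2 _).comp (continuous_pi h)

lemma IsStandardBrownianMotion.ae_zero (hB : IsStandardBrownianMotion B P) :
    ∀ᵐ ω ∂P, B 0 ω = 0 := by
  filter_upwards [ae_all_iff.2 fun i => (hB.isBrownianReal i).eval_zero_ae_eq_zero] with ω h
  ext i
  exact h i

/-- Summing over time within each component first reduces to the scalar case, as components are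
independent. The argument `1` loses nothing, since scaling can be absorbed into `h`. -/
lemma charFun_sum_inner_increments [IsProbabilityMeasure P] (hB : IsStandardBrownianMotion B P)
    (h : ℕ → EuclideanSpace ℝ (Fin m)) {t : ℕ → ℝ≥0} (ht : Monotone t) (n : ℕ) :
    charFun (P.map fun ω => ∑ k ∈ Finset.range n, (inner ℝ (h k) (B (t (k + 1)) ω - B (t k) ω) : ℝ))
        1
      = Complex.exp (-((∑ k ∈ Finset.range n,
          ‖h k‖ ^ 2 * ((t (k + 1) : ℝ) - t k) : ℝ) : ℂ) / 2) := by
  have hsum : ∀ ω, ∑ k ∈ Finset.range n, (inner ℝ (h k) (B (t (k + 1)) ω - B (t k) ω) : ℝ)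
      = ∑ i, ∑ k ∈ Finset.range n, h k i * (B (t (k + 1)) ω i - B (t k) ω i) := by
    intro ω
    rw [Finset.sum_comm]
    refine Finset.sum_congr rfl fun k _ => ?_
    simp [PiLp.inner_apply, mul_comm]
  have hind : iIndepFun (fun (i : Fin m) (ω : Ω) =>
      ∑ k ∈ Finset.range n, h k i * (B (t (k + 1)) ω i - B (t k) ω i)) P :=
    hB.indep.comp (fun i b => ∑ k ∈ Finset.range n, h k i * (b (t (k + 1)) - b (t k)))
      fun i => by fun_prop
  have hm : ∀ i : Fin m, AEMeasurable (fun ω =>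
      ∑ k ∈ Finset.range n, h k i * (B (t (k + 1)) ω i - B (t k) ω i)) P := fun i =>
    Finset.aemeasurable_fun_sum _ fun k _ =>
      (((hB.isBrownianReal i).aemeasurable _).sub ((hB.isBrownianReal i).aemeasurable _)).const_mul _
  simp_rw [hsum]
  rw [iIndepFun.charFun_map_fun_sum_eq_prod hm hind, Finset.prod_apply]
  have hi : ∀ i, charFun (P.map fun ω =>
      ∑ k ∈ Finset.range n, h k i * (B (t (k + 1)) ω i - B (t k) ω i)) 1 = _ := fun i =>
    charFun_sum_mul_increments (hB.isBrownianReal i).toIsPreBrownianReal (fun k => h k i) ht n 1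
  simp_rw [hi, ← Complex.exp_sum]
  congr 1
  simp_rw [EuclideanSpace.real_norm_sq_eq, Finset.sum_mul]
  rw [Finset.sum_comm]
  push_cast
  simp [← Finset.sum_div, ← Finset.sum_neg_distrib]

/-- The Wiener integral `∫₀ᵀ ⟨g s, dB s⟩`, written by partial integration, is a centered Gaussian
variable with variance `∫₀ᵀ ‖g s‖² ds`. -/
theorem aemeasurable_and_charFun_wienerIntegral [IsProbabilityMeasure P]
    (hB : IsStandardBrownianMotion B P)
    {g g' : ℝ → EuclideanSpace ℝ (Fin m)} (hg : ∀ s, HasDerivAt g (g' s) s)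
    (hg' : Continuous g') (T : ℝ≥0) {Z : Ω → ℝ}
    (hZ : ∀ᵐ ω ∂P, Z ω = inner ℝ (g T) (B T ω)
      - ∫ s in (0 : ℝ)..T, (inner ℝ (g' s) (B s.toNNReal ω) : ℝ)) :
    AEMeasurable Z P ∧ ∫ ω, Complex.exp (Z ω * Complex.I) ∂P
      = Complex.exp (-((∫ s in (0 : ℝ)..T, ‖g s‖ ^ 2 : ℝ) : ℂ) / 2) := by
  set t : ℕ → ℕ → ℝ≥0 := fun n k => (uniformPartition T n k).toNNReal with ht_def
  have ht : ∀ n, Monotone (t n) := fun n =>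
    fun _ _ h => Real.toNNReal_mono (uniformPartition_mono T.coe_nonneg n h)
  have htc : ∀ n k, ((t n k : ℝ≥0) : ℝ) = uniformPartition T n k := fun n k =>
    Real.coe_toNNReal _ (uniformPartition_nonneg T.coe_nonneg n k)
  set R : ℕ → Ω → ℝ := fun n ω => ∑ k ∈ Finset.range (n + 1),
    (inner ℝ (g (uniformPartition T n k)) (B (t n (k + 1)) ω - B (t n k) ω) : ℝ) with hR
  have hRm : ∀ n, AEMeasurable (R n) P := fun n =>
    Finset.aemeasurable_fun_sum _ fun k _ =>
      ((hB.aemeasurable _).sub (hB.aemeasurable _)).const_inner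
  have hlim : ∀ᵐ ω ∂P, Tendsto (fun n => R n ω) atTop (𝓝 (Z ω)) := by
    filter_upwards [hB.ae_continuous, hB.ae_zero, hZ] with ω h1 h2 h3
    have := tendsto_sum_inner_increments (b := fun s => B s.toNNReal ω) hg hg'
      (h1.comp continuous_real_toNNReal) (by simpa using h2) T.coe_nonneg
    simp only [Real.toNNReal_coe] at this
    rw [h3]
    exact this
  -- Measurability of `Z` is not assumed; it comes from the almost sure limit of the Riemann sums.
  have hZm : AEMeasurable Z P := aemeasurable_of_tendsto_metrizable_ae' hRm hlim
  refine ⟨hZm, ?_⟩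
  have hRint : ∀ n, ∫ ω, Complex.exp (R n ω * Complex.I) ∂P
      = Complex.exp (-((∑ k ∈ Finset.range (n + 1), ‖g (uniformPartition T n k)‖ ^ 2 *
          (uniformPartition T n (k + 1) - uniformPartition T n k) : ℝ) : ℂ) / 2) := by
    intro n
    have := charFun_sum_inner_increments hB (fun k => g (uniformPartition T n k)) (ht n) (n + 1)
    simp_rw [htc] at this
    rw [← this, charFun_apply_real, integral_map (hRm n) (by fun_prop)]
    simp [hR]
  have hgc : Continuous g := continuous_iff_continuousAt.2 fun s => (hg s).continuousAt
  have hv := tendsto_sum_left_endpoints (f := fun s => ‖g s‖ ^ 2) (by fun_prop) T.coe_nonneg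
  have h1 : Tendsto (fun n => ∫ ω, Complex.exp (R n ω * Complex.I) ∂P) atTop
      (𝓝 (∫ ω, Complex.exp (Z ω * Complex.I) ∂P)) := by
    refine tendsto_integral_of_dominated_convergence (fun _ => (1 : ℝ)) (fun n => ?_)
      (integrable_const _) (fun n => ?_) ?_
    · have := hRm n
      exact (AEMeasurable.aestronglyMeasurable (by fun_prop))
    · exact Eventually.of_forall fun ω => (Complex.norm_exp_ofReal_mul_I _).le
    · filter_upwards [hlim] with ω h
      have hc : Continuous fun x : ℝ => Complex.exp (x * Complex.I) := by fun_prop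
      exact (hc.tendsto _).comp h
  refine tendsto_nhds_unique h1 ?_
  simp_rw [hRint]
  have hc : Continuous fun x : ℝ => Complex.exp (-(x : ℂ) / 2) := by fun_prop
  exact (hc.tendsto _).comp hv

end WienerIntegral

/-! ### The law of the Ornstein-Uhlenbeck process and its invariant distribution. -/

section OrnsteinUhlenbeckLaw

open Filter Topology NormedSpace

section LinearFlow

variable {E ι : Type*} [NormedAddCommGroup E] [InnerProductSpace ℝ E]

lemma exp_sub_self_smul_apply (L : E →L[ℝ] E) (T : ℝ) (ξ : E) :
    exp ((T - T) • L) ξ = ξ := by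
  simp

variable [CompleteSpace E]

lemma exp_apply_of_eigenvector {M : E →L[ℝ] E} {u : E} {c : ℝ} (h : M u = c • u) :
    exp M u = Real.exp c • u := by
  have h1 := (exp_series_hasSum_exp' (𝕂 := ℝ) M).mapL (ContinuousLinearMap.apply ℝ E u)
  have h2 := (exp_series_hasSum_exp' (𝕂 := ℝ) c).smul_const u
  rw [← Real.exp_eq_exp_ℝ] at h2
  have hpow : ∀ n : ℕ, (M ^ n) u = c ^ n • u := by
    intro n
    induction n with
    | zero => simp
    | succ n ih => rw [pow_succ, mul_apply_eq_comp, h, map_smul, ih, smul_smul, pow_succ, mul_comm]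
  refine h1.unique ?_
  convert h2 using 2 with n
  simp [hpow, smul_smul]

lemma star_exp_smul (L : E →L[ℝ] E) (r : ℝ) : star (exp (r • L)) = exp (r • star L) := by
  rw [star_exp, star_smul, star_trivial (R := ℝ)]

lemma hasDerivAt_exp_sub_smul_apply (L : E →L[ℝ] E) (ξ : E) (T s : ℝ) :
    HasDerivAt (fun r => exp ((r - T) • L) ξ) (L (exp ((s - T) • L) ξ)) s := by
  have h1 := (hasDerivAt_exp_smul_const' (𝕂 := ℝ) L (s - T)).comp_sub_const s T
  simpa using h1.clm_apply (hasDerivAt_const s ξ)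

/-- Normality merges `exp (r N*) exp (r N)` into the exponential of `r (N* + N)`, which is diagonal
in `u`. Only this symmetric part governs norms. -/
lemma norm_exp_smul_apply_sq [Fintype ι] {N : E →L[ℝ] E} (hN : Commute (star N) N)
    (u : OrthonormalBasis ι ℝ E) {s : ι → ℝ}
    (hs : ∀ k, (star N + N) (u k) = (2 * s k) • u k) (r : ℝ) (ξ : E) :
    ‖exp (r • N) ξ‖ ^ 2 = ∑ k, Real.exp (2 * r * s k) * inner ℝ (u k) ξ ^ 2 := by
  have h1 : star (exp (r • N)) * exp (r • N) = exp (r • (star N + N)) := by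
    let _ : NormedAlgebra ℚ (E →L[ℝ] E) := NormedAlgebra.restrictScalars ℚ ℝ _
    rw [star_exp_smul, ← exp_add_of_commute, smul_add]
    exact (hN.smul_left r).smul_right r
  have h2 : ∀ k, exp (r • (star N + N)) (u k) = Real.exp (2 * r * s k) • u k := fun k =>
    exp_apply_of_eigenvector (by
      rw [_root_.smul_apply, hs, smul_smul]; congr 1; ring)
  have h3 : ‖exp (r • N) ξ‖ ^ 2 = inner ℝ ξ ((star (exp (r • N)) * exp (r • N)) ξ) := by
    rw [← real_inner_self_eq_norm_sq, mul_apply_eq_comp,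
      ContinuousLinearMap.star_eq_adjoint, ContinuousLinearMap.adjoint_inner_right]
  rw [h3, h1]
  nth_rewrite 2 [← u.sum_repr' ξ]
  simp only [map_sum, map_smul, h2, inner_sum, inner_smul_right]
  refine Finset.sum_congr rfl fun k _ => ?_
  rw [real_inner_comm ξ (u k)]
  ring

/-- Variation of constants for `f t = x - ∫₀ᵗ L (f s) ds + b t`. -/
lemma inner_eq_of_integral_equation {L : E →L[ℝ] E} {f b : ℝ → E} (hf : Continuous f)
    {x : E} {T : ℝ} (hT : 0 ≤ T)
    (h : ∀ t, 0 ≤ t → f t = x - (∫ s in (0 : ℝ)..t, L (f s)) + b t) (ξ : E) :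
    inner ℝ ξ (f T) = inner ℝ (exp ((-T) • star L) ξ) x + (inner ℝ ξ (b T)
      - ∫ s in (0 : ℝ)..T, inner ℝ (star L (exp ((s - T) • star L) ξ)) (b s)) := by
  set g : ℝ → E := fun s => exp ((s - T) • star L) ξ with hg
  have hgd : ∀ s, HasDerivAt g (star L (g s)) s :=
    hasDerivAt_exp_sub_smul_apply (star L) ξ T
  have hgc : Continuous g := continuous_iff_continuousAt.2 fun s => (hgd s).continuousAt
  -- `f` need not be differentiable, but `Y`, which is `f - b` on `t ≥ 0`, is; the product rule is
  -- applied to `⟨g, Y⟩`.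
  set Y : ℝ → E := fun t => x - ∫ s in (0 : ℝ)..t, L (f s) with hY
  have hLf : Continuous fun s => L (f s) := L.continuous.comp hf
  have hYd : ∀ s, HasDerivAt Y (-L (f s)) s := fun s =>
    (intervalIntegral.integral_hasDerivAt_right (hLf.intervalIntegrable _ _)
      (hLf.stronglyMeasurableAtFilter _ _) hLf.continuousAt).const_sub x
  have hYc : Continuous Y := continuous_iff_continuousAt.2 fun s => (hYd s).continuousAt
  have hftc := intervalIntegral.integral_eq_sub_of_hasDerivAt (a := 0) (b := T)
    (fun s _ => (hgd s).inner ℝ (hYd s))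
    (by apply Continuous.intervalIntegrable; fun_prop)
  -- Passing to the adjoint cancels the terms in `f`, leaving only the noise.
  have hcongr : ∫ s in (0 : ℝ)..T, (inner ℝ (g s) (-L (f s)) + inner ℝ (star L (g s)) (Y s))
      = ∫ s in (0 : ℝ)..T, -inner ℝ (star L (g s)) (b s) := by
    refine intervalIntegral.integral_congr fun s hs => ?_
    rw [Set.uIcc_of_le hT] at hs
    have h1 : f s = Y s + b s := h s hs.1
    have h2 : inner ℝ (g s) (L (f s)) = inner ℝ (star L (g s)) (f s) := by
      rw [ContinuousLinearMap.star_eq_adjoint, ContinuousLinearMap.adjoint_inner_left]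
    simp only [inner_neg_right, h2]
    rw [h1, inner_add_right]
    ring
  rw [hcongr, intervalIntegral.integral_neg] at hftc
  have hg0 : g 0 = exp ((-T) • star L) ξ := by simp [hg]
  have hgT : g T = ξ := by simp [hg]
  have hY0 : Y 0 = x := by simp [hY]
  rw [hg0, hgT, hY0] at hftc
  have h1 : f T = Y T + b T := h T hT
  rw [h1, inner_add_right]
  linarith

end LinearFlow

lemma integral_exp_two_mul_sub {c : ℝ} (hc : 0 < c) (T : ℝ) :
    ∫ s in (0 : ℝ)..T, Real.exp (2 * (s - T) * c) = (1 - Real.exp (-2 * c * T)) / (2 * c) := by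
  have hd : ∀ s, HasDerivAt (fun s => Real.exp (2 * (s - T) * c) / (2 * c))
      (Real.exp (2 * (s - T) * c)) s := by
    intro s
    have h1 : HasDerivAt (fun s => 2 * (s - T) * c) (2 * c) s := by
      simpa using (((hasDerivAt_id s).sub_const T).const_mul 2).mul_const c
    have := h1.exp.div_const (2 * c)
    rwa [mul_div_assoc, div_self (by positivity), mul_one] at this
  rw [intervalIntegral.integral_eq_sub_of_hasDerivAt (fun s _ => hd s)
    (by apply Continuous.intervalIntegrable; fun_prop), ← sub_div]
  congr 2
  · simp
  · congr 1; ring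

variable {Ω ι : Type*} [MeasurableSpace Ω] {P : Measure Ω}

/-- The standard deviations of the Ornstein-Uhlenbeck process at time `T`. -/
noncomputable def ouStd (s : ι → ℝ) (T : ℝ) (k : ι) : ℝ :=
  Real.sqrt ((1 - Real.exp (-2 * s k * T)) / (2 * s k))

lemma ouStd_sq {s : ι → ℝ} (hs : ∀ k, 0 < s k) {T : ℝ} (hT : 0 ≤ T) (k : ι) :
    ouStd s T k ^ 2 = (1 - Real.exp (-2 * s k * T)) / (2 * s k) := by
  have := hs k
  refine Real.sq_sqrt (div_nonneg (sub_nonneg.2 (Real.exp_le_one_iff.2 ?_)) (by positivity))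
  nlinarith [mul_nonneg this.le hT]

variable [Fintype ι] {m : ℕ}

/-- The law of an Ornstein-Uhlenbeck process with normal drift. -/
theorem map_ornsteinUhlenbeck_eq_diagGaussian [IsProbabilityMeasure P]
    {A : Matrix (Fin m) (Fin m) ℝ} {B : ℝ≥0 → Ω → EuclideanSpace ℝ (Fin m)}
    (hB : IsStandardBrownianMotion B P) {x : EuclideanSpace ℝ (Fin m)}
    {X : ℝ≥0 → Ω → EuclideanSpace ℝ (Fin m)}
    (hX : IsOrnsteinUhlenbeck A (1 : Matrix (Fin m) (Fin m) ℝ) B P x X)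
    {L : EuclideanSpace ℝ (Fin m) →L[ℝ] EuclideanSpace ℝ (Fin m)}
    (hLA : ∀ y, L y = Matrix.toEuclideanLin A y) (hL : Commute (star L) L)
    (u : OrthonormalBasis ι ℝ (EuclideanSpace ℝ (Fin m))) {s : ι → ℝ} (hs : ∀ k, 0 < s k)
    (hu : ∀ k, (star L + L) (u k) = (2 * s k) • u k) (T : ℝ≥0) :
    P.map (X T) = diagGaussian u (exp ((-(T : ℝ)) • L) x) (ouStd s T) := by
  -- Each centered projection of `X T` is the Wiener integral of `r ↦ exp ((r - T) L*) ξ`. The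
  -- trivial factor with `T - T` is this integrand at `r = T`, kept so that the Wiener integral
  -- theorem applies verbatim.
  have hsol : ∀ ξ, ∀ᵐ ω ∂P, inner ℝ ξ (X T ω) - inner ℝ (exp ((-(T : ℝ)) • star L) ξ) x
      = inner ℝ (exp (((T : ℝ) - T) • star L) ξ) (B T ω) - ∫ r in (0 : ℝ)..T,
        inner ℝ (star L (exp ((r - T) • star L) ξ)) (B r.toNNReal ω) := by
    intro ξ
    filter_upwards [hX, hB.ae_continuous] with ω hω hBω
    have := inner_eq_of_integral_equation (L := L) (f := fun r => X r.toNNReal ω)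
      (b := fun r => B r.toNNReal ω) (hω.1.comp continuous_real_toNNReal)
      (x := x) T.coe_nonneg (fun t ht => ?_) ξ
    · simp only [Real.toNNReal_coe] at this
      rw [this, exp_sub_self_smul_apply]
      ring
    · have h2 := hω.2 t.toNNReal
      rw [Real.coe_toNNReal t ht] at h2
      have h3 : Matrix.toEuclideanLin (1 : Matrix (Fin m) (Fin m) ℝ) (B t.toNNReal ω)
          = B t.toNNReal ω := by
        simp
      rw [h2, h3]
      simp only [hLA]
  have hgd : ∀ ξ r, HasDerivAt (fun r => exp ((r - (T : ℝ)) • star L) ξ)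
      (star L (exp ((r - (T : ℝ)) • star L) ξ)) r := fun ξ r =>
    hasDerivAt_exp_sub_smul_apply (star L) ξ T r
  have hgc : ∀ ξ, Continuous fun r => exp ((r - (T : ℝ)) • star L) ξ := fun ξ =>
    continuous_iff_continuousAt.2 fun r => (hgd ξ r).continuousAt
  have hW := fun ξ => aemeasurable_and_charFun_wienerIntegral hB (hgd ξ)
    ((star L).continuous.comp (hgc ξ)) T (hsol ξ)
  -- `X` is not assumed measurable either; its coordinates are Wiener integrals plus constants.
  have hXm : AEMeasurable (X T) P := by
    have h : AEMeasurable (fun ω i => X T ω i) P := by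
      refine aemeasurable_pi_lambda _ fun i => ?_
      have := (hW (EuclideanSpace.single i 1)).1.add_const
        (inner ℝ (exp ((-(T : ℝ)) • star L) (EuclideanSpace.single i 1)) x)
      simpa [EuclideanSpace.inner_single_left] using this
    exact (WithLp.measurable_toLp 2 _).comp_aemeasurable h
  have : IsProbabilityMeasure (P.map (X T)) := Measure.isProbabilityMeasure_map hXm
  refine Measure.ext_of_charFun (funext fun ξ => ?_)
  rw [charFun_diagGaussian, charFun_apply, integral_map hXm (by fun_prop)]
  have hvar : ∫ r in (0 : ℝ)..T, ‖exp ((r - (T : ℝ)) • star L) ξ‖ ^ 2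
      = ∑ k, ouStd s T k ^ 2 * inner ℝ (u k) ξ ^ 2 := by
    have hc : Commute (star (star L)) (star L) := by rw [star_star]; exact hL.symm
    have hu' : ∀ k, (star (star L) + star L) (u k) = (2 * s k) • u k := by
      intro k; rw [star_star, add_comm]; exact hu k
    simp_rw [fun r => norm_exp_smul_apply_sq hc u hu' r ξ]
    rw [intervalIntegral.integral_finsetSum fun k _ => by
      apply Continuous.intervalIntegrable; fun_prop]
    refine Finset.sum_congr rfl fun k _ => ?_
    rw [intervalIntegral.integral_mul_const, integral_exp_two_mul_sub (hs k),
      ouStd_sq hs T.coe_nonneg]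
  have hmean : (inner ℝ (exp ((-(T : ℝ)) • L) x) ξ : ℝ)
      = inner ℝ (exp ((-(T : ℝ)) • star L) ξ) x := by
    rw [← star_exp_smul, ContinuousLinearMap.star_eq_adjoint, ContinuousLinearMap.adjoint_inner_left,
      real_inner_comm]
  rw [← hvar, ← (hW ξ).2, hmean, ← integral_const_mul]
  refine integral_congr_ae (Eventually.of_forall fun ω => ?_)
  simp only
  rw [← Complex.exp_add, real_inner_comm]
  congr 1
  push_cast
  ring

section Invariant

variable {E : Type*} [NormedAddCommGroup E] [InnerProductSpace ℝ E] [FiniteDimensional ℝ E]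
  [MeasurableSpace E] [BorelSpace E]

lemma map_add_diagGaussian (u : OrthonormalBasis ι ℝ E) (a : E) (σ : ι → ℝ) :
    (diagGaussian u 0 σ).map (fun y => a + y) = diagGaussian u a σ := by
  rw [diagGaussian, Measure.map_map (by fun_prop) (continuous_diagAffine u 0 σ).measurable]
  congr 1
  funext z
  simp [diagAffine]

/-- Each transition law is a fixed centered Gaussian translated by `Φ x`, so averaging over `μ` is a
convolution. -/
lemma eq_conv_of_invariant {μ : Measure E} [IsProbabilityMeasure μ]
    (u : OrthonormalBasis ι ℝ E) (σ : ι → ℝ) (Φ : E →L[ℝ] E)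
    (h : ∀ S, MeasurableSet S → ∫⁻ x, diagGaussian u (Φ x) σ S ∂μ = μ S) :
    μ = (μ.map Φ) ∗ (diagGaussian u 0 σ) := by
  ext S hS
  have hm : Measurable fun p : E × E => p.1 + p.2 := by fun_prop
  rw [Measure.conv, Measure.map_apply hm hS, Measure.prod_apply (hm hS),
    lintegral_map (measurable_measure_prodMk_left (hm hS)) Φ.continuous.measurable, ← h S hS]
  refine lintegral_congr fun x => ?_
  rw [← map_add_diagGaussian, Measure.map_apply (by fun_prop) hS]
  rfl

/-- The Gaussian limit law is the only invariant distribution. -/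
theorem invariant_eq_diagGaussian {μ : Measure E} [IsProbabilityMeasure μ] {L : E →L[ℝ] E}
    (hL : Commute (star L) L) (u : OrthonormalBasis ι ℝ E) {s : ι → ℝ} (hs : ∀ k, 0 < s k)
    (hu : ∀ k, (star L + L) (u k) = (2 * s k) • u k)
    (h : ∀ T : ℝ≥0, ∀ S, MeasurableSet S →
      ∫⁻ x, diagGaussian u (exp ((-(T : ℝ)) • L) x) (ouStd s T) S ∂μ = μ S) :
    μ = diagGaussian u 0 (fun k => Real.sqrt (1 / (2 * s k))) := by
  refine Measure.ext_of_charFun (funext fun ξ => ?_)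
  have hexp : ∀ k, Tendsto (fun n : ℕ => Real.exp (-2 * s k * n)) atTop (𝓝 0) := by
    intro k
    refine Real.tendsto_exp_atBot.comp ?_
    exact (tendsto_natCast_atTop_atTop).const_mul_atTop_of_neg (by linarith [hs k])
  -- Invariance at integer times suffices: letting `n → ∞` identifies the characteristic function of
  -- `μ`.
  have hn : ∀ n : ℕ, charFun μ ξ = charFun μ (exp ((-(n : ℝ)) • star L) ξ)
      * Complex.exp (-((∑ k, (1 - Real.exp (-2 * s k * n)) / (2 * s k) *
          inner ℝ (u k) ξ ^ 2 : ℝ) : ℂ) / 2) := by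
    intro n
    have h1 := eq_conv_of_invariant u (ouStd s (n : ℝ≥0)) (exp ((-((n : ℝ≥0) : ℝ)) • L)) (h n)
    have hprob : IsProbabilityMeasure (μ.map ⇑(exp ((-((n : ℝ≥0) : ℝ)) • L))) :=
      Measure.isProbabilityMeasure_map (ContinuousLinearMap.continuous _).aemeasurable
    have h2 : charFun (μ.map ⇑(exp ((-((n : ℝ≥0) : ℝ)) • L))) ξ
        = charFun μ (exp ((-(n : ℝ)) • star L) ξ) := by
      rw [charFun_apply, charFun_apply, integral_map
        (ContinuousLinearMap.continuous _).aemeasurable (by fun_prop)]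
      refine integral_congr_ae (Eventually.of_forall fun x => ?_)
      simp only
      rw [← star_exp_smul, ContinuousLinearMap.star_eq_adjoint,
        ContinuousLinearMap.adjoint_inner_right]
      simp
    conv_lhs => rw [h1]
    rw [charFun_conv, h2, charFun_diagGaussian]
    simp only [inner_zero_left, ouStd_sq hs (NNReal.coe_nonneg _)]
    simp
  have hnorm : Tendsto (fun n : ℕ => ‖exp ((-(n : ℝ)) • star L) ξ‖ ^ 2) atTop (𝓝 0) := by
    have hc : Commute (star (star L)) (star L) := by rw [star_star]; exact hL.symm
    have hu' : ∀ k, (star (star L) + star L) (u k) = (2 * s k) • u k := by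
      intro k; rw [star_star, add_comm]; exact hu k
    simp_rw [fun r => norm_exp_smul_apply_sq hc u hu' r ξ]
    have : Tendsto (fun n : ℕ => ∑ k, Real.exp (-2 * s k * n) * inner ℝ (u k) ξ ^ 2) atTop
        (𝓝 (∑ k, 0 * inner ℝ (u k) ξ ^ 2)) :=
      tendsto_finsetSum _ fun k _ => (hexp k).mul_const _
    simp only [zero_mul, Finset.sum_const_zero] at this
    refine this.congr fun n => Finset.sum_congr rfl fun k _ => ?_
    congr 2; ring
  have hzero : Tendsto (fun n : ℕ => exp ((-(n : ℝ)) • star L) ξ) atTop (𝓝 0) := by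
    rw [tendsto_zero_iff_norm_tendsto_zero]
    have := hnorm.sqrt
    simpa using this
  -- The flow contracts `ξ` to `0`, so the contribution of the initial law disappears.
  have hlim1 : Tendsto (fun n : ℕ => charFun μ (exp ((-(n : ℝ)) • star L) ξ)) atTop (𝓝 1) := by
    have := ((continuous_charFun (μ := μ)).tendsto 0).comp hzero
    simpa [Function.comp_def] using this
  have hlim2 : Tendsto (fun n : ℕ => ∑ k, (1 - Real.exp (-2 * s k * n)) / (2 * s k) *
      inner ℝ (u k) ξ ^ 2) atTop (𝓝 (∑ k, (1 - 0) / (2 * s k) * inner ℝ (u k) ξ ^ 2)) :=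
    tendsto_finsetSum _ fun k _ => (((hexp k).const_sub 1).div_const _).mul_const _
  have hc : Continuous fun y : ℝ => Complex.exp (-(y : ℂ) / 2) := by fun_prop
  have hlim := hlim1.mul ((hc.tendsto _).comp hlim2)
  have heq := tendsto_nhds_unique (tendsto_const_nhds (x := charFun μ ξ))
    (hlim.congr fun n => (hn n).symm)
  rw [heq, charFun_diagGaussian]
  have hsq : ∀ k, Real.sqrt (1 / (2 * s k)) ^ 2 = 1 / (2 * s k) := fun k =>
    Real.sq_sqrt (by have := hs k; positivity)
  simp only [hsq, sub_zero, inner_zero_left, Complex.ofReal_zero, zero_mul, Complex.exp_zero]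

end Invariant

end OrnsteinUhlenbeckLaw

/-! ### Complex eigenvectors of a real normal matrix against a real eigenbasis of its symmetric
part. -/

section Complexification

variable {m : ℕ}

/-- The inclusion of `ℝᵐ` into `ℂᵐ`. -/
noncomputable def complexify (x : EuclideanSpace ℝ (Fin m)) : EuclideanSpace ℂ (Fin m) :=
  WithLp.toLp 2 fun i => (x i : ℂ)

lemma complexify_add (x y : EuclideanSpace ℝ (Fin m)) :
    complexify (x + y) = complexify x + complexify y := by
  ext i; simp [complexify]

lemma complexify_smul (c : ℝ) (x : EuclideanSpace ℝ (Fin m)) :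
    complexify (c • x) = (c : ℂ) • complexify x := by
  ext i; simp [complexify]

lemma complexify_sum {ι : Type*} (s : Finset ι) (f : ι → EuclideanSpace ℝ (Fin m)) :
    complexify (∑ k ∈ s, f k) = ∑ k ∈ s, complexify (f k) := by
  classical
  induction s using Finset.induction_on with
  | empty => ext i; simp [complexify]
  | insert a s ha ih => rw [Finset.sum_insert ha, Finset.sum_insert ha, complexify_add, ih]

lemma inner_complexify (x y : EuclideanSpace ℝ (Fin m)) :
    inner ℂ (complexify x) (complexify y) = ((inner ℝ x y : ℝ) : ℂ) := by
  simp [complexify, PiLp.inner_apply]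

lemma toEuclideanLin_complexify (A : Matrix (Fin m) (Fin m) ℝ) (x : EuclideanSpace ℝ (Fin m)) :
    Matrix.toEuclideanLin (A.map Complex.ofReal) (complexify x)
      = complexify (Matrix.toEuclideanLin A x) := by
  ext i
  simp [complexify, Matrix.toLpLin_apply, Matrix.mulVec, dotProduct]

lemma norm_inner_complexify_sq (v : EuclideanSpace ℂ (Fin m)) (x : EuclideanSpace ℝ (Fin m)) :
    ‖(inner ℂ v (complexify x) : ℂ)‖ ^ 2
      = (inner ℝ x (WithLp.toLp 2 fun i => (v i).re)) ^ 2
        + (inner ℝ x (WithLp.toLp 2 fun i => (v i).im)) ^ 2 := by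
  rw [← Complex.normSq_eq_norm_sq, Complex.normSq_apply]
  have h1 : (inner ℂ v (complexify x) : ℂ).re
      = inner ℝ x (WithLp.toLp 2 fun i => (v i).re) := by
    simp [complexify, PiLp.inner_apply, mul_comm]
  have h2 : (inner ℂ v (complexify x) : ℂ).im
      = -inner ℝ x (WithLp.toLp 2 fun i => (v i).im) := by
    simp [complexify, PiLp.inner_apply, mul_comm]
  rw [h1, h2]
  ring

/-- `T - l` is normal, and a normal operator has the same kernel as its adjoint. -/
lemma adjoint_apply_of_isStarNormal {E : Type*} [NormedAddCommGroup E] [InnerProductSpace ℂ E]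
    [CompleteSpace E] {T : E →L[ℂ] E} (hT : Commute (star T) T) {v : E} {l : ℂ}
    (h : T v = l • v) : star T v = (starRingEnd ℂ l) • v := by
  have hn : IsStarNormal (T - l • (1 : E →L[ℂ] E)) := by
    refine ⟨?_⟩
    rw [star_sub, star_smul, star_one]
    refine Commute.sub_left (hT.sub_right ?_) (Commute.sub_right ?_ ?_)
    · exact (Commute.one_right _).smul_right _
    · exact (Commute.one_left _).smul_left _
    · exact ((Commute.one_left _).smul_left _)
  have h1 := (ContinuousLinearMap.IsStarNormal.adjoint_apply_eq_zero_iff hn v).2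
    (by simp [h])
  rw [← ContinuousLinearMap.star_eq_adjoint, star_sub, star_smul, star_one] at h1
  simpa [sub_eq_zero] using h1

variable {A : Matrix (Fin m) (Fin m) ℝ} {l : Fin m → ℂ} {v : Fin m → EuclideanSpace ℂ (Fin m)}

lemma commute_star_toEuclideanCLM (hA : A * A.transpose = A.transpose * A) :
    Commute (star (Matrix.toEuclideanCLM (𝕜 := ℝ) A)) (Matrix.toEuclideanCLM (𝕜 := ℝ) A) := by
  rw [← map_star]
  refine Commute.map ?_ _
  rw [Matrix.star_eq_conjTranspose, Matrix.conjTranspose_eq_transpose_of_trivial]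
  exact hA.symm

/-- Normality makes `w` an eigenvector of the adjoint with eigenvalue `conj c`; moving both
operators onto `w` yields `c + conj c`. -/
lemma inner_complexify_add_star (hA : A * A.transpose = A.transpose * A)
    {w : EuclideanSpace ℂ (Fin m)} {c : ℂ}
    (hw : Matrix.toEuclideanLin (A.map Complex.ofReal) w = c • w)
    (y : EuclideanSpace ℝ (Fin m)) :
    inner ℂ w (complexify ((star (Matrix.toEuclideanCLM (𝕜 := ℝ) A)
        + Matrix.toEuclideanCLM (𝕜 := ℝ) A) y))
      = ((2 * c.re : ℝ) : ℂ) * inner ℂ w (complexify y) := by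
  set N := A.map Complex.ofReal with hN
  have hNs : star N = A.transpose.map Complex.ofReal := by
    ext i j; simp [hN]
  set T := Matrix.toEuclideanCLM (𝕜 := ℂ) N with hTdef
  have hTs : star T = Matrix.toEuclideanCLM (𝕜 := ℂ) (A.transpose.map Complex.ofReal) := by
    rw [hTdef, ← map_star, hNs]
  have hcomm : Commute (star T) T := by
    rw [hTs]
    refine Commute.map (?_ : _ * _ = _ * _) _
    rw [hN]
    change (A.transpose.map (Complex.ofRealHom : ℝ →+* ℂ)) * A.map (Complex.ofRealHom : ℝ →+* ℂ)
      = A.map (Complex.ofRealHom : ℝ →+* ℂ) * A.transpose.map (Complex.ofRealHom : ℝ →+* ℂ)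
    rw [← Matrix.map_mul, ← Matrix.map_mul, hA]
  have hTw : T w = c • w := hw
  have hTsw := adjoint_apply_of_isStarNormal hcomm hTw
  have e1 : complexify (Matrix.toEuclideanCLM (𝕜 := ℝ) A y) = T (complexify y) :=
    (toEuclideanLin_complexify A y).symm
  have e2 : complexify (star (Matrix.toEuclideanCLM (𝕜 := ℝ) A) y) = star T (complexify y) := by
    rw [hTs, ← map_star, Matrix.star_eq_conjTranspose,
      Matrix.conjTranspose_eq_transpose_of_trivial]
    exact (toEuclideanLin_complexify A.transpose y).symm
  have i1 : inner ℂ w (T (complexify y)) = c * inner ℂ w (complexify y) := by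
    rw [← ContinuousLinearMap.adjoint_inner_left, ← ContinuousLinearMap.star_eq_adjoint, hTsw,
      inner_smul_left, Complex.conj_conj]
  have i2 : inner ℂ w (star T (complexify y))
      = (starRingEnd ℂ c) * inner ℂ w (complexify y) := by
    rw [ContinuousLinearMap.star_eq_adjoint, ContinuousLinearMap.adjoint_inner_right, hTw,
      inner_smul_left]
  rw [_root_.add_apply, complexify_add, inner_add_right, e1, e2, i1, i2, ← add_mul]
  congr 1
  rw [add_comm, Complex.add_conj]

variable {ι : Type*} [Fintype ι]

/-- Eigenvectors of the symmetric part for different eigenvalues are orthogonal, and `w` is one with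
eigenvalue `2 Re c`. -/
lemma inner_complexify_eigenvector (hA : A * A.transpose = A.transpose * A)
    {w : EuclideanSpace ℂ (Fin m)} {c : ℂ}
    (hw : Matrix.toEuclideanLin (A.map Complex.ofReal) w = c • w)
    {y : EuclideanSpace ℝ (Fin m)} {s : ℝ}
    (hy : (star (Matrix.toEuclideanCLM (𝕜 := ℝ) A) + Matrix.toEuclideanCLM (𝕜 := ℝ) A) y
      = (2 * s) • y) :
    inner ℂ w (complexify y) = 0 ∨ s = c.re := by
  have h := inner_complexify_add_star hA hw y
  rw [hy, complexify_smul, inner_smul_right] at h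
  by_cases h0 : inner ℂ w (complexify y) = 0
  · exact Or.inl h0
  · right
    have := mul_right_cancel₀ h0 h
    have h2 : 2 * s = 2 * c.re := by exact_mod_cast this
    linarith

lemma orthonormal_exists_basis (hv : Orthonormal ℂ v) :
    ∃ b : OrthonormalBasis (Fin m) ℂ (EuclideanSpace ℂ (Fin m)), ∀ j, b j = v j := by
  obtain ⟨b, hb⟩ := Orthonormal.exists_orthonormalBasis_extension_of_card_eq (𝕜 := ℂ)
    (by simp) (v := v) (s := Set.univ) (hv.comp _ Subtype.val_injective)
  exact ⟨b, fun j => hb j trivial⟩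

/-- The quadratic forms of `f ((A + Aᵀ) / 2)` computed in a complex eigenbasis of the normal matrix
`A` and in a real eigenbasis of its symmetric part agree. -/
lemma sum_eigenvalues_mul_norm_inner_sq (hA : A * A.transpose = A.transpose * A)
    (hv : Orthonormal ℂ v)
    (hl : ∀ j, Matrix.toEuclideanLin (A.map Complex.ofReal) (v j) = l j • v j)
    (u : OrthonormalBasis ι ℝ (EuclideanSpace ℝ (Fin m))) {s : ι → ℝ}
    (hu : ∀ k, (star (Matrix.toEuclideanCLM (𝕜 := ℝ) A) + Matrix.toEuclideanCLM (𝕜 := ℝ) A) (u k)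
      = (2 * s k) • u k) (f : ℝ → ℝ) (x : EuclideanSpace ℝ (Fin m)) :
    ∑ j, f (l j).re * ‖(inner ℂ (v j) (complexify x) : ℂ)‖ ^ 2
      = ∑ k, f (s k) * inner ℝ (u k) x ^ 2 := by
  obtain ⟨b, hb⟩ := orthonormal_exists_basis hv
  -- `y` is `f(S) x` for the symmetric part `S`; both sides are then `⟨x, f(S) x⟩`, expanded in the
  -- two bases.
  set y : EuclideanSpace ℝ (Fin m) := ∑ k, (f (s k) * inner ℝ (u k) x) • u k with hy
  have hvy : ∀ j, inner ℂ (v j) (complexify y)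
      = (f (l j).re : ℂ) * inner ℂ (v j) (complexify x) := by
    intro j
    conv_rhs => rw [← u.sum_repr' x]
    rw [hy, complexify_sum, complexify_sum, inner_sum, inner_sum, Finset.mul_sum]
    refine Finset.sum_congr rfl fun k _ => ?_
    rw [complexify_smul, complexify_smul, inner_smul_right, inner_smul_right]
    rcases inner_complexify_eigenvector hA (hl j) (hu k) with h | h
    · simp [h]
    · rw [h]; push_cast; ring
  have h1 : inner ℂ (complexify x) (complexify y)
      = ((∑ j, f (l j).re * ‖(inner ℂ (v j) (complexify x) : ℂ)‖ ^ 2 : ℝ) : ℂ) := by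
    rw [← b.sum_inner_mul_inner]
    push_cast
    refine Finset.sum_congr rfl fun j _ => ?_
    rw [hb, hvy, ← inner_conj_symm (complexify x) (v j), ← Complex.conj_mul']
    ring
  have h2 : inner ℝ x y = ∑ k, f (s k) * inner ℝ (u k) x ^ 2 := by
    rw [hy, inner_sum]
    refine Finset.sum_congr rfl fun k _ => ?_
    rw [inner_smul_right, real_inner_comm]
    ring
  rw [inner_complexify, h2] at h1
  exact_mod_cast h1.symm

/-- The trace of `f(S)` in two bases: sum `f (Re l j) |⟨v j, u k⟩|²` over both indices, in either
order. -/
lemma sum_eigenvalues_eq (hA : A * A.transpose = A.transpose * A)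
    (hv : Orthonormal ℂ v)
    (hl : ∀ j, Matrix.toEuclideanLin (A.map Complex.ofReal) (v j) = l j • v j)
    (u : OrthonormalBasis ι ℝ (EuclideanSpace ℝ (Fin m))) {s : ι → ℝ}
    (hu : ∀ k, (star (Matrix.toEuclideanCLM (𝕜 := ℝ) A) + Matrix.toEuclideanCLM (𝕜 := ℝ) A) (u k)
      = (2 * s k) • u k) (f : ℝ → ℝ) :
    ∑ j, f (l j).re = ∑ k, f (s k) := by
  classical
  have hk : ∀ k, ∑ j, f (l j).re * ‖(inner ℂ (v j) (complexify (u k)) : ℂ)‖ ^ 2 = f (s k) := by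
    intro k
    rw [sum_eigenvalues_mul_norm_inner_sq hA hv hl u hu]
    simp [OrthonormalBasis.inner_eq_ite]
  -- Parseval in `u`, applied separately to the real and imaginary parts of `v j`.
  have hj : ∀ j, ∑ k, ‖(inner ℂ (v j) (complexify (u k)) : ℂ)‖ ^ 2 = 1 := by
    intro j
    simp_rw [norm_inner_complexify_sq, Finset.sum_add_distrib, u.sum_sq_inner_right]
    have := hv.1 j
    rw [EuclideanSpace.real_norm_sq_eq, EuclideanSpace.real_norm_sq_eq, ← Finset.sum_add_distrib]
    rw [EuclideanSpace.norm_eq, Real.sqrt_eq_one] at this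
    rw [← this]
    refine Finset.sum_congr rfl fun i _ => ?_
    rw [← Complex.normSq_eq_norm_sq, Complex.normSq_apply]
    ring
  rw [← Finset.sum_congr rfl fun k _ => hk k, Finset.sum_comm]
  refine Finset.sum_congr rfl fun j _ => ?_
  rw [← Finset.mul_sum, hj, mul_one]

/-- By Parseval `u k` is not orthogonal to every `v j`, so `s k` is the real part of some `l j`. -/
lemma symmetricPart_eigenvalue_pos (hA : A * A.transpose = A.transpose * A)
    (hv : Orthonormal ℂ v)
    (hl : ∀ j, Matrix.toEuclideanLin (A.map Complex.ofReal) (v j) = l j • v j)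
    (hpos : ∀ j, 0 < (l j).re)
    (u : OrthonormalBasis ι ℝ (EuclideanSpace ℝ (Fin m))) {s : ι → ℝ}
    (hu : ∀ k, (star (Matrix.toEuclideanCLM (𝕜 := ℝ) A) + Matrix.toEuclideanCLM (𝕜 := ℝ) A) (u k)
      = (2 * s k) • u k) (k : ι) : 0 < s k := by
  classical
  have h := sum_eigenvalues_mul_norm_inner_sq hA hv hl u hu (fun _ => 1) (u k)
  simp only [one_mul, OrthonormalBasis.inner_eq_ite, ite_pow, one_pow, ne_eq, OfNat.ofNat_ne_zero,
    not_false_eq_true, zero_pow, Finset.sum_ite_eq', Finset.mem_univ, if_true] at h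
  obtain ⟨j, -, hj⟩ := Finset.exists_ne_zero_of_sum_ne_zero (h.trans_ne one_ne_zero)
  rcases inner_complexify_eigenvector hA (hl j) (hu k) with h0 | h0
  · simp [h0] at hj
  · rw [h0]; exact hpos j

lemma exists_symmetricPart_eigenbasis {E : Type*} [NormedAddCommGroup E] [InnerProductSpace ℝ E]
    [FiniteDimensional ℝ E] (L : E →L[ℝ] E) :
    ∃ (u : OrthonormalBasis (Fin (Module.finrank ℝ E)) ℝ E) (s : Fin (Module.finrank ℝ E) → ℝ),
      ∀ k, (star L + L) (u k) = (2 * s k) • u k := by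
  have hsa : IsSelfAdjoint (star L + L) := IsSelfAdjoint.star_add_self L
  have hsymm := hsa.isSymmetric
  refine ⟨hsymm.eigenvectorBasis rfl, fun k => hsymm.eigenvalues rfl k / 2, fun k => ?_⟩
  have := hsymm.apply_eigenvectorBasis rfl k
  rw [mul_div_cancel₀ _ two_ne_zero]
  exact this

end Complexification

/-! ### The explicit formula and the two cases. -/

/-- With `q = e^{-2rt}`, multiplying by the conjugate gives `1 - √(1 - q) = q / (√(1 - q) + 1)`, and
`q² = e^{-4rt}`. -/
lemma sqrt_sub_sqrt_sq_eq {r t : ℝ} (hr : 0 < r) (ht : 0 ≤ t) :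
    (Real.sqrt ((1 - Real.exp (-2 * r * t)) / (2 * r)) - Real.sqrt (1 / (2 * r))) ^ 2
      = 1 / (2 * r) * (Real.exp (-4 * r * t) / (Real.sqrt (1 - Real.exp (-2 * r * t)) + 1) ^ 2) := by
  have hq : Real.exp (-4 * r * t) = Real.exp (-2 * r * t) ^ 2 := by
    rw [← Real.exp_nat_mul]; congr 1; push_cast; ring
  have hle : 0 ≤ 1 - Real.exp (-2 * r * t) :=
    sub_nonneg.2 (Real.exp_le_one_iff.2 (by nlinarith [mul_nonneg hr.le ht]))
  rw [hq, Real.sqrt_div hle, Real.sqrt_div zero_le_one, Real.sqrt_one, ← sub_div, div_pow,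
    Real.sq_sqrt (by positivity)]
  set a := Real.sqrt (1 - Real.exp (-2 * r * t)) with ha
  have ha0 : 0 ≤ a := Real.sqrt_nonneg _
  have hq2 : Real.exp (-2 * r * t) = 1 - a ^ 2 := by rw [ha, Real.sq_sqrt hle]; ring
  rw [hq2]
  field_simp
  ring

section Main

variable {m : ℕ} {Ω : Type*} [MeasurableSpace Ω] {P : Measure Ω} [IsProbabilityMeasure P]

/-- Both laws are diagonal in the real eigenbasis of the symmetric part, which gives the distance;
the mean term and the variance term are then carried over to the complex eigenbasis. -/
theorem wassersteinDist_ornsteinUhlenbeck_of_normal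
    {A : Matrix (Fin m) (Fin m) ℝ}
    {B : ℝ≥0 → Ω → EuclideanSpace ℝ (Fin m)} (hB : IsStandardBrownianMotion B P)
    {X : EuclideanSpace ℝ (Fin m) → ℝ≥0 → Ω → EuclideanSpace ℝ (Fin m)}
    (hX : ∀ x, IsOrnsteinUhlenbeck A (1 : Matrix (Fin m) (Fin m) ℝ) B P x (X x))
    {μ : Measure (EuclideanSpace ℝ (Fin m))} (hμ : IsInvariantDistribution X P μ)
    (hA : A * A.transpose = A.transpose * A) {l : Fin m → ℂ}
    {v : Fin m → EuclideanSpace ℂ (Fin m)} (hpos : ∀ j, 0 < (l j).re) (hv : Orthonormal ℂ v)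
    (hl : ∀ j, Matrix.toEuclideanLin (A.map Complex.ofReal) (v j) = l j • v j)
    (x : EuclideanSpace ℝ (Fin m)) (t : ℝ≥0) :
    wassersteinDist 2 (P.map (X x t)) μ =
      ENNReal.ofReal (Real.sqrt (
        ∑ j, Real.exp (-2 * (l j).re * t) *
          ((inner ℝ x (WithLp.toLp 2 fun i => (v j i).re)) ^ 2
            + (inner ℝ x (WithLp.toLp 2 fun i => (v j i).im)) ^ 2)
        + ∑ j, 1 / (2 * (l j).re) * (Real.exp (-4 * (l j).re * t) /
            (Real.sqrt (1 - Real.exp (-2 * (l j).re * t)) + 1) ^ 2))) := by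
  obtain ⟨u, s, hu⟩ := exists_symmetricPart_eigenbasis (Matrix.toEuclideanCLM (𝕜 := ℝ) A)
  have hs := symmetricPart_eigenvalue_pos hA hv hl hpos u hu
  have hL := commute_star_toEuclideanCLM hA
  have hlaw := fun y T => map_ornsteinUhlenbeck_eq_diagGaussian hB (hX y)
    (L := Matrix.toEuclideanCLM (𝕜 := ℝ) A) (fun _ => rfl) hL u hs hu T
  have := hμ.isProbabilityMeasure
  have hμ' := invariant_eq_diagGaussian hL u hs hu (μ := μ) fun T S hS => by
    simp_rw [← hlaw]; exact hμ.invariant T S hS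
  rw [hlaw, hμ', wassersteinDist_diagGaussian u _ _ (ouStd s t) _ (fun k => Real.sqrt_nonneg _)
    (fun k => Real.sqrt_nonneg _), sub_zero, norm_exp_smul_apply_sq hL u hu]
  congr 3
  · simp_rw [← norm_inner_complexify_sq]
    rw [sum_eigenvalues_mul_norm_inner_sq hA hv hl u hu (fun r => Real.exp (-2 * r * t)) x]
    refine Finset.sum_congr rfl fun k _ => ?_
    congr 2
    ring
  · rw [sum_eigenvalues_eq hA hv hl u hu (fun r => 1 / (2 * r) * (Real.exp (-4 * r * t) /
            (Real.sqrt (1 - Real.exp (-2 * r * t)) + 1) ^ 2))]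
    exact Finset.sum_congr rfl fun k _ => sqrt_sub_sqrt_sq_eq (hs k) t.coe_nonneg

lemma eigenvalue_pos_of_posDef {A : Matrix (Fin m) (Fin m) ℝ} (hA : A.PosDef)
    {v : EuclideanSpace ℝ (Fin m)} (hv : v ≠ 0) {c : ℝ}
    (h : Matrix.toEuclideanLin A v = c • v) : 0 < c := by
  have h1 := hA.dotProduct_mulVec_pos (x := v.ofLp) (by simpa using hv)
  have h2 : A.mulVec v.ofLp = c • v.ofLp := congrArg WithLp.ofLp h
  rw [h2, dotProduct_smul, smul_eq_mul] at h1
  have h3 : 0 ≤ star v.ofLp ⬝ᵥ v.ofLp := dotProduct_star_self_nonneg _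
  exact pos_of_mul_pos_left h1 h3

end Main

theorem theorem3 {m : ℕ} {Ω : Type*} [MeasurableSpace Ω] (P : Measure Ω) [IsProbabilityMeasure P]
    (A : Matrix (Fin m) (Fin m) ℝ)
    (B : ℝ≥0 → Ω → EuclideanSpace ℝ (Fin m)) (hB : IsStandardBrownianMotion B P)
    (X : EuclideanSpace ℝ (Fin m) → ℝ≥0 → Ω → EuclideanSpace ℝ (Fin m))
    (hX : ∀ x, IsOrnsteinUhlenbeck A (1 : Matrix (Fin m) (Fin m) ℝ) B P x (X x))
    (μ : Measure (EuclideanSpace ℝ (Fin m))) (hμ : IsInvariantDistribution X P μ) :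
    (A.PosDef →
      ∀ (l : Fin m → ℝ) (v : Fin m → EuclideanSpace ℝ (Fin m)),
        Orthonormal ℝ v →
        (∀ j, Matrix.toEuclideanLin A (v j) = l j • v j) →
        ∀ (x : EuclideanSpace ℝ (Fin m)) (t : ℝ≥0),
          wassersteinDist 2 (P.map (X x t)) μ =
            ENNReal.ofReal (Real.sqrt (
              ∑ j, Real.exp (-2 * l j * t) * (inner ℝ x (v j)) ^ 2
              + 1 / 2 * ∑ j, 1 / l j * (Real.exp (-4 * l j * t) /
                  (Real.sqrt (1 - Real.exp (-2 * l j * t)) + 1) ^ 2)))) ∧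
    (A * A.transpose = A.transpose * A →
      ∀ (l : Fin m → ℂ) (v : Fin m → EuclideanSpace ℂ (Fin m)),
        (∀ j, 0 < (l j).re) →
        Orthonormal ℂ v →
        (∀ j, Matrix.toEuclideanLin (A.map Complex.ofReal) (v j) = l j • v j) →
        ∀ (x : EuclideanSpace ℝ (Fin m)) (t : ℝ≥0),
          wassersteinDist 2 (P.map (X x t)) μ =
            ENNReal.ofReal (Real.sqrt (
              ∑ j, Real.exp (-2 * (l j).re * t) *
                ((inner ℝ x (WithLp.toLp 2 fun i => (v j i).re)) ^ 2
                  + (inner ℝ x (WithLp.toLp 2 fun i => (v j i).im)) ^ 2)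
              + ∑ j, 1 / (2 * (l j).re) * (Real.exp (-4 * (l j).re * t) /
                  (Real.sqrt (1 - Real.exp (-2 * (l j).re * t)) + 1) ^ 2)))) := by
  refine ⟨fun hA l v hv hl x t => ?_, fun hA l v hpos hv hl x t =>
    wassersteinDist_ornsteinUhlenbeck_of_normal hB hX hμ hA hpos hv hl x t⟩
  have hT : A.transpose = A := by
    rw [← Matrix.conjTranspose_eq_transpose_of_trivial]; exact hA.isHermitian
  have hpos : ∀ j, 0 < l j := fun j => eigenvalue_pos_of_posDef hA (hv.ne_zero j) (hl j)
  -- A real eigenbasis is also a complex one with vanishing imaginary parts, so the normal case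
  -- applies.
  have hvc : Orthonormal ℂ fun j => complexify (v j) := by
    classical
    rw [orthonormal_iff_ite] at hv ⊢
    intro i j
    rw [inner_complexify, hv]
    split_ifs <;> simp
  have h := wassersteinDist_ornsteinUhlenbeck_of_normal hB hX hμ (by rw [hT])
    (l := fun j => (l j : ℂ)) (fun j => by simpa using hpos j) hvc
    (fun j => by rw [toEuclideanLin_complexify, hl, complexify_smul]) x t
  have hre : ∀ j, (WithLp.toLp 2 fun i => (complexify (v j) i).re) = v j := fun j => by
    ext i; simp [complexify]
  have him : ∀ j, (WithLp.toLp 2 fun i => (complexify (v j) i).im)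
      = (0 : EuclideanSpace ℝ (Fin m)) := fun j => by
    ext i; simp [complexify]
  simp only [hre, him, Complex.ofReal_re, inner_zero_right] at h
  rw [h, Finset.mul_sum]
  congr 3
  · simp
  · refine Finset.sum_congr rfl fun j _ => ?_
    rw [← mul_assoc, one_div_mul_one_div]
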